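/- Let $\Omega\subset\mathbb R^2$ be a bounded simply connected domain with smooth boundary, let $L>0$, and let $D=\Omega\times(0,L)\subset\mathbb R^3$. For $v=(v^1,v^2)\in L^2(D;\mathbb R^2)$ let $\operatorname{curl}v=\partial_1v^2-\partial_2v^1$ in the sense of distributions on $D$; that is, a finite signed Radon measure $\mu$ on $D$ is $\operatorname{curl}v$ if $$\int_D\varphi\,d\mu=-\int_D v\cdot(-\partial_2\varphi,\partial_1\varphi)\,dx\qquad\text{for all }\varphi\in C^1_c(D).$$ Let $V$ be the space of all $v\in L^2(D;\mathbb R^2)$ such that $\operatorname{curl}v$ is a finite signed Radon measure on $D$, and denote by $|\operatorname{curl}v|(D)$ the total variation of this measure. Let $C^\infty(\overline D;\mathbb R^2)$ denote the restrictions to $\overline D$ of smooth fields $\mathbb R^3\to\mathbb R^2$. Then for every $v\in V$ there is a sequence $(v_k)$ in $V\cap C^\infty(\overline D;\mathbb R^2)$ such that, as $k\to\infty$, $$v_k\to v\ \text{ in }L^2(D;\mathbb R^2)\qquad\text{and}\qquad |\operatorname{curl}v_k|(D)\to|\operatorname{curl}v|(D).$$ -/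

import Mathlib

open MeasureTheory Set Filter Topology
open scoped ContDiff ENNReal

/-- The plane with its Euclidean norm. -/
abbrev Plane : Type := EuclideanSpace ℝ (Fin 2)

/-- Three-dimensional space with its Euclidean norm. -/
abbrev Space : Type := EuclideanSpace ℝ (Fin 3)

/-- `Ω` is a bounded domain (open, connected, nonempty) of the plane with smooth boundary: near each
boundary point, after a linear isometric change of coordinates, `Ω` is the set of points lying
strictly above the graph of a smooth function of one variable. -/
structure IsBoundedSmoothDomain (Ω : Set Plane) : Prop where
  isOpen : IsOpen Ω
  isConnected : IsConnected Ω
  isBounded : Bornology.IsBounded Ω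
  smooth_boundary : ∀ p ∈ frontier Ω, ∃ r : ℝ, 0 < r ∧
    ∃ (R : Plane ≃ₗᵢ[ℝ] Plane) (γ : ℝ → ℝ), ContDiff ℝ ∞ γ ∧
      ∀ x ∈ Metric.ball p r, x ∈ Ω ↔ γ ((R x) 0) < (R x) 1

/-- The open cylinder `Ω × (0, L)` in three-dimensional space. -/
def openCylinder (Ω : Set Plane) (L : ℝ) : Set Space :=
  {x | !₂[x 0, x 1] ∈ Ω ∧ x 2 ∈ Ioo 0 L}

/-- The planar perpendicular gradient `(-∂₂ φ, ∂₁ φ)` of a function of three variables. -/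
noncomputable def gradPerp (φ : Space → ℝ) (x : Space) : Plane :=
  !₂[-(fderiv ℝ φ x (EuclideanSpace.single 1 1)), fderiv ℝ φ x (EuclideanSpace.single 0 1)]

/-- `φ` is a `C¹` function with compact support contained in `D`. -/
structure IsTestFunction (D : Set Space) (φ : Space → ℝ) : Prop where
  contDiff : ContDiff ℝ 1 φ
  hasCompactSupport : HasCompactSupport φ
  tsupport_subset : tsupport φ ⊆ D

/-- The integral of a real function against a finite signed measure, through the Jordan
decomposition. -/
noncomputable def signedIntegral (μ : SignedMeasure Space) (φ : Space → ℝ) : ℝ :=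
  (∫ x, φ x ∂μ.toJordanDecomposition.posPart) - ∫ x, φ x ∂μ.toJordanDecomposition.negPart

/-- The finite signed Borel (hence Radon) measure `μ`, concentrated on `D`, is the distributional
planar curl `∂₁ v² - ∂₂ v¹` of `v` in `D`. -/
structure IsCurl (D : Set Space) (v : Space → Plane) (μ : SignedMeasure Space) : Prop where
  concentrated : μ.totalVariation Dᶜ = 0
  integral_eq : ∀ φ : Space → ℝ, IsTestFunction D φ →
    signedIntegral μ φ = -∫ x in D, inner ℝ (v x) (gradPerp φ x)

/-- The square integrable planar fields on `D` whose curl is a finite Radon measure on `D`. Fields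
are represented by functions on the whole space, of which only the values on `D` matter. -/
def curlSpace (D : Set Space) : Set (Space → Plane) :=
  {v | MemLp v 2 (volume.restrict D) ∧ ∃ μ : SignedMeasure Space, IsCurl D v μ}

open Classical in
/-- The curl of `v` in `D` as a finite signed measure concentrated on `D` (zero if there is none).
For open `D` it is uniquely determined, see `IsCurl.curlMeasure_eq`. -/
noncomputable def curlMeasure (D : Set Space) (v : Space → Plane) : SignedMeasure Space :=
  if h : ∃ μ : SignedMeasure Space, IsCurl D v μ then h.choose else 0

/-- Two finite measures with the same integrals of all test functions agree on open subsets of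
`D`. -/
theorem measure_le_of_integral_testFunction_eq {D W : Set Space} {α β : Measure Space}
    [IsFiniteMeasure α] [IsFiniteMeasure β]
    (h : ∀ φ : Space → ℝ, IsTestFunction D φ → ∫ x, φ x ∂α = ∫ x, φ x ∂β)
    (hW : IsOpen W) (hWD : W ⊆ D) : α W ≤ β W := by
  rw [hW.measure_eq_iSup_isCompact]
  refine iSup₂_le fun K hKW => iSup_le fun hK => ?_
  obtain ⟨K', hK', hKK', hK'W⟩ := exists_compact_between hK hW hKW
  obtain ⟨f, hf0, hf1, hf01⟩ := exists_contMDiffMap_zero_one_nhds_of_isClosed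
    (modelWithCornersSelf ℝ Space) (n := 1) (s := (interior K')ᶜ) (t := K)
    isOpen_interior.isClosed_compl hK.isClosed
    (disjoint_compl_left_iff_subset.mpr hKK')
  have hfc : ContDiff ℝ 1 f := f.contMDiff.contDiff
  have hsupp : Function.support f ⊆ K' := by
    intro x hx
    by_contra hxK
    have : x ∈ (interior K')ᶜ := fun hi => hxK (interior_subset hi)
    exact hx (subset_of_mem_nhdsSet hf0 this)
  have hts : tsupport f ⊆ K' := closure_minimal hsupp hK'.isClosed
  have hcs : HasCompactSupport f := hK'.of_isClosed_subset (isClosed_tsupport f) hts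
  have hft : IsTestFunction D f := ⟨hfc, hcs, hts.trans (hK'W.trans hWD)⟩
  have hone : ∀ x ∈ K, f x = 1 := fun x hx => subset_of_mem_nhdsSet hf1 hx
  have hia : Integrable f α := hfc.continuous.integrable_of_hasCompactSupport hcs
  have hib : Integrable f β := hfc.continuous.integrable_of_hasCompactSupport hcs
  have h1 : α.real K ≤ ∫ x, f x ∂α := by
    rw [← integral_indicator_one hK.measurableSet]
    refine integral_mono ((integrable_const (1 : ℝ)).indicator hK.measurableSet) hia fun x => ?_
    by_cases hx : x ∈ K
    · simp [hx, hone x hx]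
    · simpa [hx] using (hf01 x).1
  have h2 : ∫ x, f x ∂β ≤ β.real W := by
    rw [← integral_indicator_one hW.measurableSet]
    refine integral_mono hib ((integrable_const (1 : ℝ)).indicator hW.measurableSet) fun x => ?_
    by_cases hx : x ∈ W
    · simpa [hx] using (hf01 x).2
    · have : f x = 0 := by
        by_contra hne
        exact hx (hK'W (hsupp hne))
      simp [hx, this]
  have h3 : α.real K ≤ β.real W := h1.trans ((h f hft).trans_le h2)
  exact (ENNReal.toReal_le_toReal (measure_ne_top _ _) (measure_ne_top _ _)).mp h3

/-- Two finite measures concentrated on the open set `D` with the same integrals of all test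
functions are equal. -/
theorem measure_eq_of_integral_testFunction_eq {D : Set Space} (hD : IsOpen D)
    {α β : Measure Space} [IsFiniteMeasure α] [IsFiniteMeasure β] (hα : α Dᶜ = 0) (hβ : β Dᶜ = 0)
    (h : ∀ φ : Space → ℝ, IsTestFunction D φ → ∫ x, φ x ∂α = ∫ x, φ x ∂β) : α = β := by
  have key : ∀ U : Set Space, IsOpen U → α U = β U := by
    intro U hU
    have e : ∀ {ρ : Measure Space}, ρ Dᶜ = 0 → ρ U = ρ (U ∩ D) := fun {ρ} hρ =>
      (measure_inter_conull hρ).symm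
    rw [e hα, e hβ]
    exact le_antisymm
      (measure_le_of_integral_testFunction_eq h (hU.inter hD) inter_subset_right)
      (measure_le_of_integral_testFunction_eq (fun φ hφ => (h φ hφ).symm) (hU.inter hD)
        inter_subset_right)
  exact ext_of_generate_finite _ BorelSpace.measurable_eq isPiSystem_isOpen
    (fun U hU => key U hU) (key _ isOpen_univ)

/-- The curl measure of a field in an open set is unique. -/
theorem IsCurl.unique {D : Set Space} (hD : IsOpen D) {v : Space → Plane}
    {μ ν : SignedMeasure Space} (hμ : IsCurl D v μ) (hν : IsCurl D v ν) : μ = ν := by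
  have hμ0 := hμ.concentrated
  have hν0 := hν.concentrated
  simp only [SignedMeasure.totalVariation, Measure.add_apply, add_eq_zero] at hμ0 hν0
  have hadd : μ.toJordanDecomposition.posPart + ν.toJordanDecomposition.negPart
      = ν.toJordanDecomposition.posPart + μ.toJordanDecomposition.negPart := by
    refine measure_eq_of_integral_testFunction_eq hD (by simp [hμ0, hν0]) (by simp [hμ0, hν0])
      fun φ hφ => ?_
    have hi : ∀ (ρ : Measure Space) [IsFiniteMeasure ρ], Integrable φ ρ := fun ρ _ =>
      hφ.contDiff.continuous.integrable_of_hasCompactSupport hφ.hasCompactSupport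
    have heq := (hμ.integral_eq φ hφ).trans (hν.integral_eq φ hφ).symm
    unfold signedIntegral at heq
    rw [integral_add_measure (hi _) (hi _), integral_add_measure (hi _) (hi _)]
    linarith
  rw [← μ.toSignedMeasure_toJordanDecomposition, ← ν.toSignedMeasure_toJordanDecomposition]
  ext s hs
  have hs' : (μ.toJordanDecomposition.posPart + ν.toJordanDecomposition.negPart).real s
      = (ν.toJordanDecomposition.posPart + μ.toJordanDecomposition.negPart).real s := by
    rw [hadd]
  rw [measureReal_add_apply, measureReal_add_apply] at hs'
  simp only [JordanDecomposition.toSignedMeasure, Measure.toSignedMeasure_sub_apply hs]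
  linarith

/-- On an open set, `curlMeasure` is the curl whenever there is one. -/
theorem IsCurl.curlMeasure_eq {D : Set Space} (hD : IsOpen D) {v : Space → Plane}
    {μ : SignedMeasure Space} (hμ : IsCurl D v μ) : curlMeasure D v = μ := by
  have h : ∃ μ : SignedMeasure Space, IsCurl D v μ := ⟨μ, hμ⟩
  rw [curlMeasure, dif_pos h]
  exact h.choose_spec.unique hD hμ

/-- The total variation `|curl v|(D)`. -/
noncomputable def curlVariation (D : Set Space) (v : Space → Plane) : ℝ≥0∞ :=
  (curlMeasure D v).totalVariation D

/-- `u` is smooth up to the boundary of `D`: on the closure of `D` it coincides with a smooth field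
defined on the whole space. -/
def IsSmoothUpToBoundary (D : Set Space) (u : Space → Plane) : Prop :=
  ∃ w : Space → Plane, ContDiff ℝ ∞ w ∧ EqOn u w (closure D)

/-! The lower bound on the limit of the variations is duality: |curl v|(D) is the supremum of ∫ φ
d(curl v) over test functions with |φ| ≤ 1, and each such integral is L²-continuous in v
(`eventually_lt_curlVariation`). It remains to find smooth fields L²-close to v whose curl has mass
at most |curl v|(D) + ε; this is `IsCurl.exists_contDiff_approx`.

Plain mollification fails near the boundary, where the kernel reaches outside D and the zero
extension of v may have additional curl. But D has interior cones, locally uniform at every point of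
its closure (`hasInteriorConeAt_openCylinder`). Take a partition of unity ζ_i on the closure,
subordinate to finitely many balls on which a cone is available, and convolve ζ_i v with a kernel
η_i shifted so that from x ∈ D it looks only into the cone.

Write μ = curl v. For x ∈ D, the function ζ_i η_i(x - ·) is then a test function on D, and the
product rule gives curl(η_i * (ζ_i v))(x) = ∫ ζ_i η_i(x - ·) dμ + (η_i * (v · ∇^⊥ζ_i))(x)
(`IsCurl.planarCurl_mollify_smul`). By Tonelli the first terms have total mass at most ∑ ∫ ζ_i d|μ|
= |μ|(D). The second terms are L²-close to v · ∇^⊥ζ_i, and these sum to zero on D because ∑ ζ_i = 1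
there; so their sum is small in L¹(D). -/

open scoped Convolution

/-! ### Mollification as an approximate identity in Lᵖ -/

section Mollify

variable {E : Type*} [NormedAddCommGroup E] [NormedSpace ℝ E]

/-- A smooth probability density supported in the ball of radius `r` around `c`. -/
structure IsMollifier (η : Space → ℝ) (c : Space) (r : ℝ) : Prop where
  contDiff : ContDiff ℝ ∞ η
  hasCompactSupport : HasCompactSupport η
  nonneg : ∀ x, 0 ≤ η x
  integral_eq_one : ∫ x, η x = 1
  support_subset : Function.support η ⊆ Metric.ball c r

theorem exists_isMollifier (c : Space) {r : ℝ} (hr : 0 < r) : ∃ η, IsMollifier η c r := by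
  let φ : ContDiffBump c := ⟨r / 2, r, half_pos hr, half_lt_self hr⟩
  exact ⟨φ.normed volume, φ.contDiff_normed, φ.hasCompactSupport_normed, φ.nonneg_normed,
    φ.integral_normed, φ.support_normed_eq.subset⟩

theorem IsMollifier.mono {η : Space → ℝ} {c c' : Space} {r r' : ℝ} (h : IsMollifier η c r)
    (hs : Metric.ball c r ⊆ Metric.ball c' r') : IsMollifier η c' r' :=
  { h with support_subset := h.support_subset.trans hs }

theorem IsMollifier.integrable {η : Space → ℝ} {c : Space} {r : ℝ} (h : IsMollifier η c r) :
    Integrable η :=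
  h.contDiff.continuous.integrable_of_hasCompactSupport h.hasCompactSupport

theorem IsMollifier.lintegral_eq_one {η : Space → ℝ} {c : Space} {r : ℝ} (h : IsMollifier η c r) :
    ∫⁻ x, ENNReal.ofReal (η x) = 1 := by
  rw [← ofReal_integral_eq_lintegral_ofReal h.integrable (ae_of_all _ h.nonneg),
    h.integral_eq_one, ENNReal.ofReal_one]

/-- The convolution of `f` with the kernel `η`. -/
noncomputable def mollify (η : Space → ℝ) (f : Space → E) : Space → E :=
  η ⋆[ContinuousLinearMap.lsmul ℝ ℝ, volume] f

theorem IsMollifier.contDiff_mollify {η : Space → ℝ} {c : Space} {r : ℝ}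
    (h : IsMollifier η c r) {f : Space → E} (hf : LocallyIntegrable f) :
    ContDiff ℝ ∞ (mollify η f) :=
  h.hasCompactSupport.contDiff_convolution_left _ h.contDiff hf

theorem IsMollifier.mollify_sub {η : Space → ℝ} {c : Space} {r : ℝ}
    (h : IsMollifier η c r) {f g : Space → E} (hf : LocallyIntegrable f)
    (hg : LocallyIntegrable g) : mollify η (f - g) = mollify η f - mollify η g := by
  have h1 := h.hasCompactSupport.convolutionExists_left
    (ContinuousLinearMap.lsmul ℝ ℝ) h.contDiff.continuous hf
  have h2 := h.hasCompactSupport.convolutionExists_left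
    (ContinuousLinearMap.lsmul ℝ ℝ) h.contDiff.continuous hg
  ext x
  simp only [mollify, convolution_def, Pi.sub_apply, map_sub]
  exact integral_sub (h1 x) (h2 x)

/-- Convolution with a probability density does not increase `Lᵖ` norms. -/
theorem IsMollifier.eLpNorm_mollify_le {η : Space → ℝ} {c : Space} {r : ℝ}
    (h : IsMollifier η c r) {p : ℝ≥0∞} (hp : 1 ≤ p) (hp' : p ≠ ⊤) {f : Space → E}
    (hf : AEStronglyMeasurable f) : eLpNorm (mollify η f) p ≤ eLpNorm f p := by
  have hp0 : p ≠ 0 := (zero_lt_one.trans_le hp).ne'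
  have hpos : 0 < p.toReal := ENNReal.toReal_pos hp0 hp'
  have hηm : Measurable fun x => ENNReal.ofReal (η x) :=
    h.contDiff.continuous.measurable.ennreal_ofReal
  -- Viewing η as a probability measure turns the pointwise bound into Jensen's inequality
  -- (monotonicity of Lᵖ norms in p); Tonelli and translation invariance do the rest.
  set ν : Measure Space := volume.withDensity fun x => ENNReal.ofReal (η x) with hν
  have : IsProbabilityMeasure ν := ⟨by
    rw [hν, withDensity_apply _ MeasurableSet.univ, setLIntegral_univ, h.lintegral_eq_one]⟩
  have hm : AEStronglyMeasurable (fun z : Space × Space => f (z.1 - z.2)) (volume.prod ν) :=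
    hf.comp_quasiMeasurePreserving (quasiMeasurePreserving_sub_of_right_invariant volume ν)
  have hpt : ∀ᵐ x, ‖mollify η f x‖ₑ ^ p.toReal ≤ ∫⁻ t, ‖f (x - t)‖ₑ ^ p.toReal ∂ν := by
    filter_upwards [hm.prodMk_left] with x hx
    have h1 : ‖mollify η f x‖ₑ ≤ eLpNorm (fun t => f (x - t)) 1 ν := by
      rw [eLpNorm_one_eq_lintegral_enorm, hν, lintegral_withDensity_eq_lintegral_mul_non_measurable
        _ hηm (ae_of_all _ fun _ => ENNReal.ofReal_lt_top)]
      refine (enorm_integral_le_lintegral_enorm _).trans (lintegral_mono fun t => ?_)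
      simp only [ContinuousLinearMap.lsmul_apply, enorm_smul, Pi.mul_apply]
      rw [Real.enorm_of_nonneg (h.nonneg t)]
    have h2 := h1.trans (eLpNorm_le_eLpNorm_of_exponent_le hp hx)
    rw [eLpNorm_eq_lintegral_rpow_enorm_toReal hp0 hp'] at h2
    calc _ ≤ ((∫⁻ t, ‖f (x - t)‖ₑ ^ p.toReal ∂ν) ^ (1 / p.toReal)) ^ p.toReal := by gcongr
      _ = _ := by rw [← ENNReal.rpow_mul, one_div_mul_cancel hpos.ne', ENNReal.rpow_one]
  rw [eLpNorm_eq_lintegral_rpow_enorm_toReal hp0 hp', eLpNorm_eq_lintegral_rpow_enorm_toReal hp0 hp']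
  gcongr ?_ ^ _
  calc _ ≤ ∫⁻ x, ∫⁻ t, ‖f (x - t)‖ₑ ^ p.toReal ∂ν := lintegral_mono_ae hpt
    _ = ∫⁻ t, (∫⁻ x, ‖f (x - t)‖ₑ ^ p.toReal) ∂ν :=
      lintegral_lintegral_swap (hm.enorm.pow_const _)
    _ = ∫⁻ _, (∫⁻ x, ‖f x‖ₑ ^ p.toReal) ∂ν := by
      congr 1
      ext t
      exact lintegral_sub_right_eq_self (fun x => ‖f x‖ₑ ^ p.toReal) t
    _ = _ := by simp

/-- Uniform continuity makes the error uniformly small, and the error lives on a fixed compact set,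
so it is small in Lᵖ. Density of such functions then gives the general case. -/
theorem exists_eLpNorm_mollify_sub_le_of_continuous [CompleteSpace E] {p : ℝ≥0∞}
    {g : Space → E} (hg : Continuous g) (hgc : HasCompactSupport g) {ε : ℝ≥0∞} (hε : ε ≠ 0) :
    ∃ δ > 0, ∀ η, IsMollifier η 0 δ → eLpNorm (mollify η g - g) p ≤ ε := by
  -- Contains the support of the error for every kernel of radius at most 1, which is why the radius
  -- below is capped at 1.
  set K := Metric.cthickening 1 (tsupport g) with hK
  have hKc : IsCompact K := hgc.isCompact.cthickening
  obtain ⟨C, hC0, hC⟩ := ENNReal.exists_nnreal_pos_mul_lt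
    (a := volume K ^ p.toReal⁻¹) (b := ε)
    (ENNReal.rpow_ne_top_of_nonneg (by positivity) hKc.measure_lt_top.ne) hε
  obtain ⟨δ, hδ, hu⟩ := Metric.uniformContinuous_iff.mp
    (hgc.uniformContinuous_of_continuous hg) C hC0
  refine ⟨min δ 1, by positivity, fun η hη => ?_⟩
  have hd : ∀ x, ‖(mollify η g - g) x‖ ≤ C := fun x => by
    rw [Pi.sub_apply, ← dist_eq_norm]
    refine dist_convolution_le C.2 hη.support_subset hη.nonneg hη.integral_eq_one
      hg.aestronglyMeasurable fun y hy => (hu ?_).le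
    exact (Metric.mem_ball.mp hy).trans_le (min_le_left _ _)
  have hsupp : Function.support (mollify η g - g) ⊆ K := by
    intro x hx
    by_contra hxK
    have hgx : g x = 0 := by
      by_contra hne
      exact hxK (Metric.self_subset_cthickening _ (subset_tsupport g hne))
    refine hx ?_
    rw [Pi.sub_apply, hgx, sub_zero, mollify, convolution_def]
    refine integral_eq_zero_of_ae (ae_of_all _ fun t => ?_)
    by_cases ht : η t = 0
    · simp [ht]
    · have htb : dist t 0 < min δ 1 := hη.support_subset ht
      have : g (x - t) = 0 := by
        by_contra hne
        refine hxK (Metric.mem_cthickening_of_dist_le x (x - t) 1 _ (subset_tsupport g hne) ?_)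
        rw [dist_eq_norm, sub_sub_cancel]
        rw [dist_zero_right] at htb
        exact htb.le.trans (min_le_right _ _)
      simp [this]
  rw [← eLpNorm_restrict_eq_of_support_subset hsupp]
  refine (eLpNorm_le_of_ae_bound (ae_of_all _ hd)).trans ?_
  rw [Measure.restrict_apply_univ, ENNReal.ofReal_coe_nnreal, mul_comm]
  exact hC.le

/-- Mollification is an approximate identity in `Lᵖ`. -/
theorem exists_eLpNorm_mollify_sub_le [CompleteSpace E] {p : ℝ≥0∞} (hp : 1 ≤ p) (hp' : p ≠ ⊤)
    {f : Space → E} (hf : MemLp f p) {ε : ℝ≥0∞} (hε : ε ≠ 0) :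
    ∃ δ > 0, ∀ η, IsMollifier η 0 δ → eLpNorm (mollify η f - f) p ≤ ε := by
  have hε3 : ε / 3 ≠ 0 := by simp [hε]
  obtain ⟨g, hgc, hfg, hg, hgp⟩ := hf.exists_hasCompactSupport_eLpNorm_sub_le hp' hε3
  obtain ⟨δ, hδ, h⟩ := exists_eLpNorm_mollify_sub_le_of_continuous (p := p) hg hgc hε3
  refine ⟨δ, hδ, fun η hη => ?_⟩
  have hfl : LocallyIntegrable f := hf.locallyIntegrable hp
  have hgl : LocallyIntegrable g := hgp.locallyIntegrable hp
  have hsm : AEStronglyMeasurable (f - g) := hf.1.sub hgp.1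
  -- The outer terms are controlled by density of g and the Lᵖ contraction property, uniformly in η.
  have e : mollify η f - f = mollify η (f - g) + ((mollify η g - g) + (g - f)) := by
    rw [hη.mollify_sub hfl hgl]; abel
  have m1 := (hη.contDiff_mollify (hfl.sub hgl)).continuous.aestronglyMeasurable
    (μ := (volume : Measure Space))
  have m2 := ((hη.contDiff_mollify hgl).continuous.sub hg).aestronglyMeasurable
    (μ := (volume : Measure Space))
  have t1 : eLpNorm (mollify η (f - g)) p ≤ ε / 3 :=
    (hη.eLpNorm_mollify_le hp hp' hsm).trans hfg
  have t2 : eLpNorm (mollify η g - g) p ≤ ε / 3 := h η hη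
  have t3 : eLpNorm (g - f) p ≤ ε / 3 := by rwa [eLpNorm_sub_comm]
  rw [e, ← ENNReal.add_thirds ε, add_assoc]
  exact (eLpNorm_add_le m1 (m2.add (hgp.1.sub hf.1)) hp).trans
    (add_le_add t1 ((eLpNorm_add_le m2 (hgp.1.sub hf.1) hp).trans (add_le_add t2 t3)))

end Mollify

/-! ### Interior cones of the cylinder -/

/-- Near `p`, the set `S` contains with each point a truncated open cone, with uniform opening and
direction. -/
def HasInteriorConeAt {E : Type*} [NormedAddCommGroup E] [NormedSpace ℝ E] (S : Set E) (p : E) :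
    Prop :=
  ∃ y : E, ∃ δ > 0, ∀ x ∈ S, dist x p < δ → ∀ t ∈ Ioo 0 δ, Metric.ball (x + t • y) (δ * t) ⊆ S

theorem IsOpen.hasInteriorConeAt {E : Type*} [NormedAddCommGroup E] [NormedSpace ℝ E] {S : Set E}
    (hS : IsOpen S) {p : E} (hp : p ∈ S) : HasInteriorConeAt S p := by
  obtain ⟨r, hr, h⟩ := Metric.isOpen_iff.mp hS p hp
  refine ⟨0, min (r / 2) 1, by positivity, fun x _ hx t ht z hz => h ?_⟩
  rw [smul_zero, add_zero, Metric.mem_ball] at hz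
  have h1 := min_le_left (r / 2) 1
  have h2 := min_le_right (r / 2) 1
  have h3 : min (r / 2) 1 * t ≤ 1 * (r / 2) := by
    have := ht.1; have := ht.2
    gcongr
    linarith
  rw [Metric.mem_ball]
  linarith [dist_triangle z x p]

/-- At a boundary point the cone points vertically in the graph coordinates; a local Lipschitz
constant of the graph function bounds how wide it may open. -/
theorem IsBoundedSmoothDomain.hasInteriorConeAt {Ω : Set Plane} (hΩ : IsBoundedSmoothDomain Ω)
    {p : Plane} (hp : p ∈ closure Ω) : HasInteriorConeAt Ω p := by
  by_cases hpΩ : p ∈ Ω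
  · exact hΩ.isOpen.hasInteriorConeAt hpΩ
  obtain ⟨r, hr, R, γ, hγ, hgr⟩ := hΩ.smooth_boundary p
    ⟨hp, by rwa [hΩ.isOpen.interior_eq]⟩
  obtain ⟨K, s, hs, hK⟩ := (hγ.of_le (by norm_num)).contDiffAt.exists_lipschitzOnWith
    (x := (R p) 0) (f := γ)
  obtain ⟨σ, hσ, hσs⟩ := Metric.mem_nhds_iff.mp hs
  set e : Plane := R.symm (EuclideanSpace.single 1 1) with he
  have hRe : R e = EuclideanSpace.single 1 1 := by simp [he]
  have hne : ‖e‖ = 1 := by rw [← R.norm_map, hRe]; simp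
  -- All points considered lie within 3δ of p, hence inside the graph and Lipschitz neighbourhoods.
  -- A point of the cone gains height more than t - δt while the graph rises by at most Kδt, so δ(K
  -- + 1) ≤ 1 keeps it above the graph.
  set δ : ℝ := min (min (r / 4) (σ / 4)) (1 / (K + 1)) with hδ
  have hK1 : (0 : ℝ) < K + 1 := by positivity
  have hδ0 : 0 < δ := by positivity
  have hδr : δ ≤ r / 4 := (min_le_left _ _).trans (min_le_left _ _)
  have hδσ : δ ≤ σ / 4 := (min_le_left _ _).trans (min_le_right _ _)
  have hδK : δ * (K + 1) ≤ 1 := by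
    rw [← le_div_iff₀ hK1]; exact min_le_right _ _
  have hδ1 : δ ≤ 1 := (min_le_right _ _).trans (by rw [div_le_one hK1]; simp)
  refine ⟨e, δ, hδ0, fun x hx hxp t ht z hz => ?_⟩
  have ht0 := ht.1
  have htδ := ht.2
  rw [Metric.mem_ball, dist_eq_norm] at hz
  have hδt : δ * t ≤ t := by nlinarith
  have hzx : dist z x < 2 * δ := by
    rw [dist_eq_norm]
    calc ‖z - x‖ = ‖(z - (x + t • e)) + t • e‖ := by congr 1; abel
      _ ≤ ‖z - (x + t • e)‖ + ‖t • e‖ := norm_add_le _ _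
      _ < δ * t + t := by rw [norm_smul, hne, Real.norm_of_nonneg ht0.le, mul_one]; linarith
      _ ≤ 2 * δ := by linarith
  have hzp : dist z p < 3 * δ := by linarith [dist_triangle z x p]
  have hc : ∀ (w w' : Plane) (i : Fin 2), |(R w) i - (R w') i| ≤ dist w w' := fun w w' i => by
    rw [← R.dist_map w w', dist_eq_norm]
    simpa using PiLp.norm_apply_le (R w - R w') i
  have hxs : (R x) 0 ∈ s := hσs (by
    rw [Metric.mem_ball, Real.dist_eq]; linarith [hc x p 0])
  have hzs : (R z) 0 ∈ s := hσs (by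
    rw [Metric.mem_ball, Real.dist_eq]; linarith [hc z p 0])
  rw [hgr z (by rw [Metric.mem_ball]; linarith)]
  rw [hgr x (by rw [Metric.mem_ball]; linarith)] at hx
  have h0 : |(R z) 0 - (R x) 0| ≤ δ * t := by
    have := hc z (x + t • e) 0
    simp only [map_add, map_smul, hRe, PiLp.add_apply, PiLp.smul_apply] at this
    rw [dist_eq_norm] at this
    simp at this
    linarith
  have h1 : |(R z) 1 - ((R x) 1 + t)| < δ * t := by
    have := hc z (x + t • e) 1
    simp only [map_add, map_smul, hRe, PiLp.add_apply, PiLp.smul_apply] at this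
    rw [dist_eq_norm] at this
    simp at this
    linarith
  have hL : |γ ((R z) 0) - γ ((R x) 0)| ≤ K * (δ * t) := by
    have := hK.dist_le_mul _ hzs _ hxs
    rw [Real.dist_eq, Real.dist_eq] at this
    exact this.trans (by gcongr)
  have hfin : (δ * (K + 1)) * t ≤ 1 * t := by gcongr
  have := (abs_lt.mp h1).1
  have := (abs_le.mp hL).2
  linarith

/-- Move up when a < L and down otherwise; the bound δ ≤ 1 prevents crossing the near endpoint, and
the quarter length prevents reaching the far one. -/
theorem hasInteriorConeAt_Ioo {L : ℝ} (hL : 0 < L) (a : ℝ) : HasInteriorConeAt (Ioo 0 L) a := by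
  rcases lt_or_ge a L with h | h
  · refine ⟨1, min ((L - a) / 4) 1, by have := sub_pos.mpr h; positivity, fun x hx hxa t ht z hz => ?_⟩
    have h1 := min_le_left ((L - a) / 4) 1
    have h2 : min ((L - a) / 4) 1 * t ≤ 1 * t := by gcongr; exacts [ht.1.le, min_le_right _ _]
    rw [Real.dist_eq] at hxa
    rw [Metric.mem_ball, Real.dist_eq] at hz
    have h3 := abs_lt.mp hxa
    have h4 := abs_lt.mp hz
    have h5 := ht.1
    have h6 := ht.2
    have h7 := hx.1
    simp only [smul_eq_mul, mul_one] at h4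
    constructor <;> linarith
  · refine ⟨-1, min (L / 4) 1, by positivity, fun x hx hxa t ht z hz => ?_⟩
    have h1 := min_le_left (L / 4) 1
    have h2 : min (L / 4) 1 * t ≤ 1 * t := by gcongr; exacts [ht.1.le, min_le_right _ _]
    rw [Real.dist_eq] at hxa
    rw [Metric.mem_ball, Real.dist_eq] at hz
    have h3 := abs_lt.mp hxa
    have h4 := abs_lt.mp hz
    have h5 := ht.1
    have h6 := ht.2
    have h7 := hx.2
    simp only [smul_eq_mul] at h4
    constructor <;> linarith

/-- The horizontal part of a point of space. -/
noncomputable def toPlane (x : Space) : Plane := !₂[x 0, x 1]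

theorem continuous_toPlane : Continuous toPlane := by
  unfold toPlane
  fun_prop

theorem dist_toPlane_le (x y : Space) : dist (toPlane x) (toPlane y) ≤ dist x y := by
  rw [EuclideanSpace.dist_eq, EuclideanSpace.dist_eq]
  apply Real.sqrt_le_sqrt
  simp only [Fin.sum_univ_two, Fin.sum_univ_three, toPlane]
  simp

theorem dist_apply_le (x y : Space) (i : Fin 3) : dist (x i) (y i) ≤ dist x y := by
  simpa [dist_eq_norm] using PiLp.norm_apply_le (x - y) i

theorem isOpen_openCylinder {Ω : Set Plane} (hΩ : IsOpen Ω) (L : ℝ) :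
    IsOpen (openCylinder Ω L) :=
  (hΩ.preimage continuous_toPlane).inter
    (isOpen_Ioo.preimage (by fun_prop : Continuous fun x : Space => x 2))

theorem isBounded_openCylinder {Ω : Set Plane} (hΩ : Bornology.IsBounded Ω) (L : ℝ) :
    Bornology.IsBounded (openCylinder Ω L) := by
  obtain ⟨M, hM⟩ := hΩ.exists_norm_le
  refine isBounded_iff_forall_norm_le.mpr ⟨√(M ^ 2 + L ^ 2), fun x hx => ?_⟩
  have h := hM _ hx.1
  rw [EuclideanSpace.norm_eq] at h ⊢
  apply Real.sqrt_le_sqrt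
  have h2 := (Real.sqrt_le_iff.mp h).2
  have h3 := hx.2.1
  have h4 := hx.2.2
  simp only [Fin.sum_univ_two, Fin.sum_univ_three, Real.norm_eq_abs, sq_abs] at h2 ⊢
  simp at h2
  nlinarith

/-- The cone property passes to products: combine the two directions and take the smaller δ, since
both projections are 1-Lipschitz. This also handles the edges of the cylinder, where the boundary is
not smooth. -/
theorem hasInteriorConeAt_openCylinder {Ω : Set Plane} (hΩ : IsBoundedSmoothDomain Ω)
    {L : ℝ} (hL : 0 < L) {p : Space} (hp : p ∈ closure (openCylinder Ω L)) :
    HasInteriorConeAt (openCylinder Ω L) p := by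
  have hq : toPlane p ∈ closure Ω :=
    map_mem_closure continuous_toPlane hp fun x hx => hx.1
  obtain ⟨y, δ, hδ, h⟩ := hΩ.hasInteriorConeAt hq
  obtain ⟨a, δ', hδ', h'⟩ := hasInteriorConeAt_Ioo hL (p 2)
  refine ⟨!₂[y 0, y 1, a], min δ δ', by positivity, fun x hx hxp t ht z hz => ⟨?_, ?_⟩⟩
  · refine h _ hx.1 ((dist_toPlane_le x p).trans_lt (hxp.trans_le (min_le_left _ _))) t
      ⟨ht.1, ht.2.trans_le (min_le_left _ _)⟩ ?_
    have e : (!₂[x 0, x 1] : Plane) + t • y = toPlane (x + t • !₂[y 0, y 1, a]) := by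
      ext i
      fin_cases i <;> simp [toPlane]
    rw [e, Metric.mem_ball]
    refine (dist_toPlane_le _ _).trans_lt ((Metric.mem_ball.mp hz).trans_le ?_)
    gcongr
    exacts [ht.1.le, min_le_left _ _]
  · refine h' _ hx.2 ((dist_apply_le x p 2).trans_lt (hxp.trans_le (min_le_right _ _))) t
      ⟨ht.1, ht.2.trans_le (min_le_right _ _)⟩ ?_
    have e : x 2 + t • a = (x + t • !₂[y 0, y 1, a]) 2 := by
      simp
    rw [e, Metric.mem_ball]
    refine (dist_apply_le _ _ _).trans_lt ((Metric.mem_ball.mp hz).trans_le ?_)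
    gcongr
    exacts [ht.1.le, min_le_right _ _]

/-! ### Signed measures: densities and duality for the total variation -/

/-- The sign of f provides a Hahn decomposition, and the Jordan decomposition is unique. -/
theorem toJordanDecomposition_withDensityᵥ {α : Type*} [MeasurableSpace α] {ρ : Measure α}
    {f : α → ℝ} (hf : Integrable f ρ) (hfm : Measurable f) :
    (SignedMeasure.toJordanDecomposition (ρ.withDensityᵥ f)).posPart
        = ρ.withDensity (fun x => ENNReal.ofReal (f x)) ∧
      (SignedMeasure.toJordanDecomposition (ρ.withDensityᵥ f)).negPart
        = ρ.withDensity (fun x => ENNReal.ofReal (-f x)) := by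
  have h1 := isFiniteMeasure_withDensity_ofReal hf.2
  have h2 := isFiniteMeasure_withDensity_ofReal hf.neg.2
  let j : JordanDecomposition α :=
    { posPart := ρ.withDensity fun x => ENNReal.ofReal (f x)
      negPart := ρ.withDensity fun x => ENNReal.ofReal (-f x)
      posPart_finite := h1
      negPart_finite := h2
      mutuallySingular := by
        refine ⟨{x | f x ≤ 0}, measurableSet_le hfm measurable_const, ?_, ?_⟩
        · rw [withDensity_apply _ (measurableSet_le hfm measurable_const)]
          refine setLIntegral_eq_zero (measurableSet_le hfm measurable_const) fun x hx => ?_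
          exact ENNReal.ofReal_of_nonpos hx
        · rw [withDensity_apply _ (measurableSet_le hfm measurable_const).compl]
          refine setLIntegral_eq_zero (measurableSet_le hfm measurable_const).compl fun x hx => ?_
          have hx' : 0 < f x := not_le.mp hx
          exact ENNReal.ofReal_of_nonpos (by simpa using hx'.le) }
  have : (SignedMeasure.toJordanDecomposition (ρ.withDensityᵥ f)) = j :=
    SignedMeasure.toJordanDecomposition_eq (j := j)
      (withDensityᵥ_eq_withDensity_pos_part_sub_withDensity_neg_part hf)
  rw [this]
  exact ⟨rfl, rfl⟩

theorem totalVariation_withDensityᵥ {α : Type*} [MeasurableSpace α] {ρ : Measure α}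
    {f : α → ℝ} (hf : Integrable f ρ) (hfm : Measurable f) :
    SignedMeasure.totalVariation (ρ.withDensityᵥ f) = ρ.withDensity (fun x => ‖f x‖ₑ) := by
  obtain ⟨h1, h2⟩ := toJordanDecomposition_withDensityᵥ hf hfm
  rw [SignedMeasure.totalVariation, h1, h2, ← withDensity_add_left hfm.ennreal_ofReal]
  congr 1
  ext x
  rcases le_total 0 (f x) with h | h
  · simp [Real.enorm_of_nonneg h, ENNReal.ofReal_of_nonpos (neg_nonpos.mpr h)]
  · rw [← enorm_neg, Real.enorm_of_nonneg (neg_nonneg.mpr h)]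
    simp [ENNReal.ofReal_of_nonpos h]

theorem signedIntegral_withDensityᵥ {ρ : Measure Space} {f : Space → ℝ} (hf : Integrable f ρ)
    (hfm : Measurable f) {φ : Space → ℝ} (hφ : Continuous φ) (hφc : HasCompactSupport φ) :
    signedIntegral (ρ.withDensityᵥ f) φ = ∫ x, φ x * f x ∂ρ := by
  obtain ⟨h1, h2⟩ := toJordanDecomposition_withDensityᵥ hf hfm
  have f1 := isFiniteMeasure_withDensity_ofReal hf.2
  have f2 := isFiniteMeasure_withDensity_ofReal hf.neg.2
  have i1 : Integrable φ (ρ.withDensity fun x => ENNReal.ofReal (f x)) :=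
    hφ.integrable_of_hasCompactSupport hφc
  have i2 : Integrable φ (ρ.withDensity fun x => ENNReal.ofReal (-f x)) :=
    hφ.integrable_of_hasCompactSupport hφc
  have m2 : Measurable fun x => ENNReal.ofReal (-f x) := hfm.neg.ennreal_ofReal
  rw [signedIntegral, h1, h2]
  rw [integral_withDensity_eq_integral_toReal_smul hfm.ennreal_ofReal
      (ae_of_all _ fun _ => ENNReal.ofReal_lt_top),
    integral_withDensity_eq_integral_toReal_smul m2
      (ae_of_all _ fun _ => ENNReal.ofReal_lt_top), ← integral_sub]
  · congr 1
    ext x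
    simp only [smul_eq_mul, ENNReal.toReal_ofReal']
    rcases le_total 0 (f x) with h | h
    · rw [max_eq_left h, max_eq_right (neg_nonpos.mpr h)]; ring
    · rw [max_eq_right h, max_eq_left (neg_nonneg.mpr h)]; ring
  · exact (integrable_withDensity_iff_integrable_smul₀' hfm.ennreal_ofReal.aemeasurable
      (ae_of_all _ fun _ => ENNReal.ofReal_lt_top)).mp i1
  · exact (integrable_withDensity_iff_integrable_smul₀' m2.aemeasurable
      (ae_of_all _ fun _ => ENNReal.ofReal_lt_top)).mp i2

instance (μ : SignedMeasure Space) : IsFiniteMeasure μ.totalVariation := by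
  unfold SignedMeasure.totalVariation
  infer_instance

theorem enorm_signedIntegral_le (μ : SignedMeasure Space) (φ : Space → ℝ) :
    ‖signedIntegral μ φ‖ₑ ≤ ∫⁻ x, ‖φ x‖ₑ ∂μ.totalVariation := by
  rw [SignedMeasure.totalVariation, lintegral_add_measure, signedIntegral]
  exact (enorm_sub_le).trans
    (add_le_add (enorm_integral_le_lintegral_enorm _) (enorm_integral_le_lintegral_enorm _))

/-- Smooth Urysohn functions between a compact and an open set. -/
theorem exists_testFunction_eq_one {K W : Set Space} (hK : IsCompact K) (hW : IsOpen W)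
    (hKW : K ⊆ W) : ∃ φ : Space → ℝ, IsTestFunction W φ ∧ (∀ x ∈ K, φ x = 1) ∧
      ∀ x, φ x ∈ Icc (0 : ℝ) 1 := by
  obtain ⟨K', hK', hKK', hK'W⟩ := exists_compact_between hK hW hKW
  obtain ⟨f, hf0, hf1, hf01⟩ := exists_contMDiffMap_zero_one_nhds_of_isClosed
    (modelWithCornersSelf ℝ Space) (n := 1) (s := (interior K')ᶜ) (t := K)
    isOpen_interior.isClosed_compl hK.isClosed (disjoint_compl_left_iff_subset.mpr hKK')
  have hsupp : Function.support f ⊆ K' := by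
    intro x hx
    by_contra hxK
    have : x ∈ (interior K')ᶜ := fun hi => hxK (interior_subset hi)
    exact hx (subset_of_mem_nhdsSet hf0 this)
  have hts : tsupport f ⊆ K' := closure_minimal hsupp hK'.isClosed
  exact ⟨f, ⟨f.contMDiff.contDiff, hK'.of_isClosed_subset (isClosed_tsupport f) hts,
    hts.trans hK'W⟩, fun x hx => subset_of_mem_nhdsSet hf1 hx, hf01⟩

/-- The total variation is the supremum of the integrals of test functions bounded by one. -/
theorem exists_testFunction_lt_signedIntegral {D : Set Space} (hD : IsOpen D)
    {μ : SignedMeasure Space} (hμ : μ.totalVariation Dᶜ = 0) {c : ℝ≥0∞}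
    (hc : c < μ.totalVariation D) :
    ∃ φ, IsTestFunction D φ ∧ (∀ x, |φ x| ≤ 1) ∧ c < ENNReal.ofReal (signedIntegral μ φ) := by
  set α := μ.toJordanDecomposition.posPart with hα
  set β := μ.toJordanDecomposition.negPart with hβ
  have hV : μ.totalVariation = α + β := rfl
  rw [hV, Measure.add_apply, add_eq_zero] at hμ
  rw [hV, Measure.add_apply] at hc
  -- A Hahn set: α lives on D \ S and β on D ∩ S. Compact sets exhausting these two pieces are
  -- disjoint, so a test function can be 1 on one and -1 on the other.
  obtain ⟨S, hS, hαS, hβS⟩ := μ.toJordanDecomposition.mutuallySingular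
  have hDm := hD.measurableSet
  have hαP : α (D \ S) = α univ := by
    rw [measure_sdiff_null hαS, ← measure_add_measure_compl (μ := α) hDm, hμ.1, add_zero]
  have hβN : β (D ∩ S) = β univ := by
    rw [inter_comm, measure_inter_conull hμ.2]
    have := measure_add_measure_compl (μ := β) hS
    rw [← this, hβS, add_zero]
  have hc' : c < α univ + β univ :=
    hc.trans_le (add_le_add (measure_mono (subset_univ _)) (measure_mono (subset_univ _)))
  have hct : c ≠ ⊤ := hc'.ne_top
  set a := α.real univ
  set b := β.real univ
  have hcab : c.toReal < a + b := by
    have := (ENNReal.toReal_lt_toReal hct (by simp)).mpr hc'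
    rwa [ENNReal.toReal_add (by simp) (by simp)] at this
  -- Each of α and β costs at most 2ε below, so the total loss 4ε stays under the gap 8ε.
  set ε := (a + b - c.toReal) / 8 with hε
  have hε0 : 0 < ε := by rw [hε]; linarith
  have hεe : ENNReal.ofReal ε ≠ 0 := by simpa using hε0
  obtain ⟨K, hKs, hK, hαK⟩ := (hDm.diff hS).exists_isCompact_lt_add (μ := α)
    (measure_ne_top _ _) hεe
  obtain ⟨K', hKs', hK', hβK⟩ := (hDm.inter hS).exists_isCompact_lt_add (μ := β)
    (measure_ne_top _ _) hεe
  rw [hαP] at hαK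
  rw [hβN] at hβK
  have hreal : ∀ (ρ : Measure Space) [IsFiniteMeasure ρ] (s : Set Space),
      ρ univ < ρ s + ENNReal.ofReal ε → ρ.real univ < ρ.real s + ε := fun ρ _ s h => by
    have := (ENNReal.toReal_lt_toReal (by simp) (by simp)).mpr h
    rwa [ENNReal.toReal_add (by simp) (by simp), ENNReal.toReal_ofReal hε0.le] at this
  obtain ⟨φ, hφ, hφ1, hφ01⟩ := exists_testFunction_eq_one hK (hD.sdiff hK'.isClosed)
    (fun x hx => ⟨(hKs hx).1, fun h => (hKs hx).2 (hKs' h).2⟩)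
  obtain ⟨ψ, hψ, hψ1, hψ01⟩ := exists_testFunction_eq_one hK' (hD.sdiff hK.isClosed)
    (fun x hx => ⟨(hKs' hx).1, fun h => (hKs h).2 (hKs' hx).2⟩)
  have hφ0 : ∀ x ∈ K', φ x = 0 := fun x hx => by
    by_contra hne
    exact (hφ.tsupport_subset (subset_tsupport φ hne)).2 hx
  have hψ0 : ∀ x ∈ K, ψ x = 0 := fun x hx => by
    by_contra hne
    exact (hψ.tsupport_subset (subset_tsupport ψ hne)).2 hx
  have htest : IsTestFunction D (φ - ψ) :=
    ⟨hφ.contDiff.sub hψ.contDiff, hφ.hasCompactSupport.sub hψ.hasCompactSupport,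
      (tsupport_sub φ ψ).trans (union_subset (hφ.tsupport_subset.trans sdiff_subset)
        (hψ.tsupport_subset.trans sdiff_subset))⟩
  have habs : ∀ x, |(φ - ψ) x| ≤ 1 := fun x => by
    have h1 := hφ01 x
    have h2 := hψ01 x
    rw [Pi.sub_apply, abs_le]
    constructor <;> linarith [h1.1, h1.2, h2.1, h2.2]
  have key : ∀ (ρ : Measure Space) [IsFiniteMeasure ρ] (C : Set Space) (f : Space → ℝ),
      IsCompact C → Integrable f ρ → (∀ x ∈ C, f x = 1) → (∀ x, |f x| ≤ 1) →
      ρ.real univ < ρ.real C + ε → ρ.real univ - 2 * ε ≤ ∫ x, f x ∂ρ := by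
    intro ρ _ C f hC hf hf1 hfa hρ
    -- This function is a lower bound for f: it equals 1 on C and -1 elsewhere.
    have hi : Integrable (fun x => 2 * C.indicator (1 : Space → ℝ) x - 1) ρ :=
      (((integrable_const (1 : ℝ)).indicator hC.measurableSet).const_mul 2).sub
        (integrable_const 1)
    have : ∫ x, (2 * C.indicator (1 : Space → ℝ) x - 1) ∂ρ ≤ ∫ x, f x ∂ρ := by
      refine integral_mono hi hf fun x => ?_
      by_cases hx : x ∈ C
      · simp only [indicator_of_mem hx, hf1 x hx, Pi.one_apply]; norm_num
      · simp only [indicator_of_notMem hx]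
        linarith [(abs_le.mp (hfa x)).1]
    have hi1 : Integrable (fun x => 2 * C.indicator (1 : Space → ℝ) x) ρ :=
      ((integrable_const (1 : ℝ)).indicator hC.measurableSet).const_mul 2
    rw [integral_sub hi1 (integrable_const 1), integral_const_mul, integral_indicator_one hC.measurableSet] at this
    simp at this
    linarith
  have hi : ∀ (ρ : Measure Space) [IsFiniteMeasure ρ], Integrable (φ - ψ) ρ := fun ρ _ =>
    htest.contDiff.continuous.integrable_of_hasCompactSupport htest.hasCompactSupport
  refine ⟨φ - ψ, htest, habs, ?_⟩
  rw [ENNReal.lt_ofReal_iff_toReal_lt hct, signedIntegral]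
  have k1 := key α K (φ - ψ) hK (hi α) (fun x hx => by simp [hφ1 x hx, hψ0 x hx]) habs
    (hreal α K hαK)
  have k2 := key β K' (-(φ - ψ)) hK' (hi β).neg (fun x hx => by simp [hφ0 x hx, hψ1 x hx])
    (fun x => by rw [Pi.neg_apply, abs_neg]; exact habs x) (hreal β K' hβK)
  have e2 : ∫ x, (-(φ - ψ)) x ∂β = -∫ x, (φ - ψ) x ∂β := integral_neg _
  rw [e2] at k2
  have : c.toReal = a + b - 8 * ε := by rw [hε]; ring
  change _ < ∫ x, (φ - ψ) x ∂α - ∫ x, (φ - ψ) x ∂β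
  change a - 2 * ε ≤ _ at k1
  change b - 2 * ε ≤ _ at k2
  linarith

/-! ### The curl of continuously differentiable fields -/

/-- The pointwise planar curl `∂₁ w² - ∂₂ w¹` of a differentiable field. -/
noncomputable def planarCurl (w : Space → Plane) (x : Space) : ℝ :=
  fderiv ℝ w x (EuclideanSpace.single 0 1) 1 - fderiv ℝ w x (EuclideanSpace.single 1 1) 0

theorem continuous_planarCurl {w : Space → Plane} (hw : ContDiff ℝ 1 w) :
    Continuous (planarCurl w) := by
  have h := hw.continuous_fderiv one_ne_zero
  unfold planarCurl
  fun_prop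

theorem planarCurl_sum {ι : Type*} (s : Finset ι) {w : ι → Space → Plane} {x : Space}
    (hw : ∀ i ∈ s, DifferentiableAt ℝ (w i) x) :
    planarCurl (∑ i ∈ s, w i) x = ∑ i ∈ s, planarCurl (w i) x := by
  simp [planarCurl, fderiv_sum hw, Finset.sum_sub_distrib]

theorem continuous_gradPerp {φ : Space → ℝ} (hφ : ContDiff ℝ 1 φ) : Continuous (gradPerp φ) := by
  have h := hφ.continuous_fderiv one_ne_zero
  unfold gradPerp
  fun_prop

theorem gradPerp_eq_zero {φ : Space → ℝ} {x : Space} (hx : x ∉ tsupport φ) :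
    gradPerp φ x = 0 := by
  rw [gradPerp, fderiv_of_notMem_tsupport ℝ hx]
  ext i
  fin_cases i <;> simp

theorem gradPerp_mul {φ ψ : Space → ℝ} {x : Space} (hφ : DifferentiableAt ℝ φ x)
    (hψ : DifferentiableAt ℝ ψ x) :
    gradPerp (fun y => φ y * ψ y) x = φ x • gradPerp ψ x + ψ x • gradPerp φ x := by
  simp only [gradPerp, fderiv_fun_mul hφ hψ]
  ext i
  fin_cases i
  · simp; ring
  · simp

theorem inner_gradPerp (a : Plane) (φ : Space → ℝ) (x : Space) :
    inner ℝ a (gradPerp φ x) = fderiv ℝ φ x (EuclideanSpace.single 0 1) * a 1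
      - fderiv ℝ φ x (EuclideanSpace.single 1 1) * a 0 := by
  simp [gradPerp, PiLp.inner_apply, Fin.sum_univ_two]
  ring

/-- Integration by parts in each coordinate; compact support of φ removes boundary terms. -/
theorem integral_mul_planarCurl {w : Space → Plane} (hw : ContDiff ℝ 1 w) {φ : Space → ℝ}
    (hφ : ContDiff ℝ 1 φ) (hφc : HasCompactSupport φ) :
    ∫ x, φ x * planarCurl w x = -∫ x, inner ℝ (w x) (gradPerp φ x) := by
  have hw' := hw.continuous_fderiv one_ne_zero
  have hφ' := hφ.continuous_fderiv one_ne_zero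
  have hφc' : HasCompactSupport (fderiv ℝ φ) := hφc.fderiv (𝕜 := ℝ)
  have hwd := hw.differentiable one_ne_zero
  have hcoord : ∀ (x e : Space) (i : Fin 2),
      fderiv ℝ (fun x => w x i) x e = fderiv ℝ w x e i := fun x e i => by
    have := ((EuclideanSpace.proj i : Plane →L[ℝ] ℝ).hasFDerivAt.comp x
      (hwd x).hasFDerivAt).fderiv
    exact congrArg (fun A : Space →L[ℝ] ℝ => A e) this
  have hi1 : ∀ (e : Space) (i : Fin 2), Integrable fun x => φ x * fderiv ℝ w x e i := fun e i =>
    Continuous.integrable_of_hasCompactSupport (hφ.continuous.mul (by fun_prop)) hφc.mul_right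
  have hi2 : ∀ (e : Space) (i : Fin 2), Integrable fun x => fderiv ℝ φ x e * w x i := fun e i =>
    Continuous.integrable_of_hasCompactSupport
      (Continuous.mul (by fun_prop) (by have := hw.continuous; fun_prop))
      (HasCompactSupport.mul_right
        (hφc'.comp_left (g := fun A : Space →L[ℝ] ℝ => A e) rfl))
  have parts : ∀ (e : Space) (i : Fin 2),
      ∫ x, φ x * fderiv ℝ w x e i = -∫ x, fderiv ℝ φ x e * w x i := fun e i => by
    have := integral_mul_fderiv_eq_neg_fderiv_mul_of_integrable (μ := (volume : Measure Space))
      (f := φ) (g := fun x => w x i) (v := e) (hi2 e i) (by simpa only [hcoord] using hi1 e i)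
      (Continuous.integrable_of_hasCompactSupport
        (hφ.continuous.mul (by have := hw.continuous; fun_prop)) hφc.mul_right)
      (fun x _ => hφ.differentiable one_ne_zero x) (fun x _ => by have := hwd x; fun_prop)
    simpa only [hcoord] using this
  simp only [planarCurl, mul_sub, inner_gradPerp]
  rw [integral_sub (hi1 _ _) (hi1 _ _), parts, parts, integral_sub (hi2 _ _) (hi2 _ _)]
  ring

theorem integrableOn_planarCurl {D : Set Space} (hD : Bornology.IsBounded D) {w : Space → Plane}
    (hw : ContDiff ℝ 1 w) : IntegrableOn (planarCurl w) D :=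
  ((continuous_planarCurl hw).continuousOn.integrableOn_compact hD.isCompact_closure).mono_set
    subset_closure

/-- The curl measure of a continuously differentiable field has the pointwise curl as density. -/
theorem isCurl_withDensityᵥ {D : Set Space} (hD : MeasurableSet D) (hDb : Bornology.IsBounded D)
    {w : Space → Plane} (hw : ContDiff ℝ 1 w) :
    IsCurl D w ((volume.restrict D).withDensityᵥ (planarCurl w)) := by
  have hi := integrableOn_planarCurl hDb hw
  have hm := (continuous_planarCurl hw).measurable
  refine ⟨?_, fun φ hφ => ?_⟩
  · rw [totalVariation_withDensityᵥ hi hm, withDensity_apply _ hD.compl,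
      Measure.restrict_restrict hD.compl, compl_inter_self]
    simp
  · have h0 : ∀ x, x ∉ D → x ∉ tsupport φ := fun x hx h => hx (hφ.tsupport_subset h)
    rw [signedIntegral_withDensityᵥ hi hm hφ.contDiff.continuous hφ.hasCompactSupport,
      setIntegral_eq_integral_of_forall_compl_eq_zero, integral_mul_planarCurl hw hφ.contDiff
      hφ.hasCompactSupport, setIntegral_eq_integral_of_forall_compl_eq_zero]
    · intro x hx
      rw [gradPerp_eq_zero (h0 x hx), inner_zero_right]
    · intro x hx
      rw [image_eq_zero_of_notMem_tsupport (h0 x hx), zero_mul]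

/-- Reduces the upper bound for the approximants to an L¹ estimate of their pointwise curl. -/
theorem curlVariation_eq_lintegral {D : Set Space} (hD : IsOpen D) (hDb : Bornology.IsBounded D)
    {w : Space → Plane} (hw : ContDiff ℝ 1 w) :
    curlVariation D w = ∫⁻ x in D, ‖planarCurl w x‖ₑ := by
  rw [curlVariation, (isCurl_withDensityᵥ hD.measurableSet hDb hw).curlMeasure_eq hD,
    totalVariation_withDensityᵥ (integrableOn_planarCurl hDb hw)
      (continuous_planarCurl hw).measurable, withDensity_apply _ hD.measurableSet,
    Measure.restrict_restrict hD.measurableSet, inter_self]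

theorem memLp_inner_of_continuous {D : Set Space} (hDm : MeasurableSet D)
    (hD : Bornology.IsBounded D) {p : ℝ≥0∞}
    {v ψ : Space → Plane} (hv : MemLp v p (volume.restrict D)) (hψ : Continuous ψ) :
    MemLp (fun x => inner ℝ (v x) (ψ x)) p (volume.restrict D) := by
  obtain ⟨C, hC⟩ := hD.isCompact_closure.exists_bound_of_continuousOn hψ.continuousOn
  refine hv.of_le_mul (c := C) (hv.1.inner hψ.aestronglyMeasurable) ?_
  filter_upwards [ae_restrict_mem hDm] with x hx
  calc _ ≤ ‖v x‖ * ‖ψ x‖ := norm_inner_le_norm _ _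
    _ ≤ ‖v x‖ * C := by gcongr; exact hC x (subset_closure hx)
    _ = _ := mul_comm _ _

theorem memLp_smul_of_continuous {D : Set Space} (hDm : MeasurableSet D)
    (hD : Bornology.IsBounded D) {p : ℝ≥0∞} {v : Space → Plane} {ζ : Space → ℝ}
    (hv : MemLp v p (volume.restrict D)) (hζ : Continuous ζ) :
    MemLp (fun x => ζ x • v x) p (volume.restrict D) := by
  obtain ⟨C, hC⟩ := hD.isCompact_closure.exists_bound_of_continuousOn hζ.continuousOn
  refine hv.of_le_mul (c := C) (hζ.aestronglyMeasurable.smul hv.1) ?_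
  filter_upwards [ae_restrict_mem hDm] with x hx
  rw [norm_smul]
  gcongr
  exact hC x (subset_closure hx)

/-! ### The curl of mollified truncations -/

theorem fderiv_comp_const_sub {η : Space → ℝ} (hη : Differentiable ℝ η) (x y e : Space) :
    fderiv ℝ (fun y => η (x - y)) y e = -fderiv ℝ η (x - y) e := by
  have h1 : HasFDerivAt (fun y : Space => x - y) (-ContinuousLinearMap.id ℝ Space) y :=
    (hasFDerivAt_id y).const_sub x
  have h2 := ((hη (x - y)).hasFDerivAt.comp y h1).fderiv
  have := congrArg (fun A : Space →L[ℝ] ℝ => A e) h2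
  simpa [Function.comp_def] using this

/-- The derivative of a convolution falls on the kernel; passing from η to y ↦ η (x - y) produces
the sign. -/
theorem planarCurl_mollify {η : Space → ℝ} {c : Space} {r : ℝ} (h : IsMollifier η c r)
    {u : Space → Plane} (hu : LocallyIntegrable u) (x : Space) :
    planarCurl (mollify η u) x = -∫ y, inner ℝ (u y) (gradPerp (fun y => η (x - y)) y) := by
  have hη1 : ContDiff ℝ 1 η := h.contDiff.of_le (by norm_num)
  have hd := h.hasCompactSupport.hasFDerivAt_convolution_left
    (ContinuousLinearMap.lsmul ℝ ℝ : ℝ →L[ℝ] Plane →L[ℝ] Plane) hη1 hu x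
  have hex := (h.hasCompactSupport.fderiv (𝕜 := ℝ)).convolutionExists_left
    ((ContinuousLinearMap.lsmul ℝ ℝ : ℝ →L[ℝ] Plane →L[ℝ] Plane).precompL Space)
    (hη1.continuous_fderiv one_ne_zero) hu x
  -- The curl as a continuous linear functional of the derivative, so that it commutes with the
  -- convolution integral.
  let Λ : (Space →L[ℝ] Plane) →L[ℝ] ℝ :=
    (EuclideanSpace.proj 1 : Plane →L[ℝ] ℝ) ∘L
        (ContinuousLinearMap.apply ℝ Plane (EuclideanSpace.single 0 1 : Space))
      - (EuclideanSpace.proj 0 : Plane →L[ℝ] ℝ) ∘L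
        (ContinuousLinearMap.apply ℝ Plane (EuclideanSpace.single 1 1 : Space))
  have e1 : planarCurl (mollify η u) x = Λ (fderiv ℝ (mollify η u) x) := rfl
  rw [e1, mollify, hd.fderiv, convolution_def, ← Λ.integral_comp_comm hex,
    ← integral_sub_left_eq_self _ volume x, ← integral_neg]
  congr 1
  ext y
  rw [inner_gradPerp, fderiv_comp_const_sub (hη1.differentiable one_ne_zero),
    fderiv_comp_const_sub (hη1.differentiable one_ne_zero), sub_sub_cancel]
  simp only [Λ, ContinuousLinearMap.precompL_apply, _root_.sub_apply,
    ContinuousLinearMap.comp_apply, ContinuousLinearMap.apply_apply,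
    ContinuousLinearMap.lsmul_apply, PiLp.proj_apply, PiLp.smul_apply, smul_eq_mul]
  ring

/-- The curl of a mollified truncation of `v` at a point which only sees `D` through the
truncation. -/
theorem IsCurl.planarCurl_mollify_smul {D : Set Space} (hD : MeasurableSet D)
    (hDb : Bornology.IsBounded D)
    {v : Space → Plane} {μ : SignedMeasure Space} (hμ : IsCurl D v μ)
    (hv : MemLp v 2 (volume.restrict D)) {η ζ : Space → ℝ} {c : Space} {r : ℝ}
    (h : IsMollifier η c r) (hζ : ContDiff ℝ ∞ ζ) {x : Space}
    (hx : ∀ z ∈ tsupport ζ, x - z ∈ tsupport η → z ∈ D) :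
    planarCurl (mollify η (D.indicator fun y => ζ y • v y)) x
      = signedIntegral μ (fun y => ζ y * η (x - y))
        + mollify η (D.indicator fun y => inner ℝ (v y) (gradPerp ζ y)) x := by
  have hη1 : ContDiff ℝ 1 η := h.contDiff.of_le (by norm_num)
  have hζ1 : ContDiff ℝ 1 ζ := hζ.of_le (by norm_num)
  have hφ1 : ContDiff ℝ 1 fun y => η (x - y) := hη1.comp (contDiff_const.sub contDiff_id)
  have hφc : HasCompactSupport fun y => η (x - y) :=
    h.hasCompactSupport.comp_homeomorph (Homeomorph.subLeft x)
  have : IsFiniteMeasure (volume.restrict D) := ⟨by simpa using hDb.measure_lt_top⟩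
  have hv1 : MemLp v 1 (volume.restrict D) := hv.mono_exponent (by norm_num)
  -- The hypothesis `hx` enters here: it keeps the support of the product inside D, so the
  -- definition of the distributional curl applies.
  have htest : IsTestFunction D fun y => ζ y * η (x - y) := by
    refine ⟨hζ1.mul hφ1, hφc.mul_left, fun z hz => hx z (tsupport_mul_subset_left hz) ?_⟩
    have h2 : z ∈ tsupport fun y => η (x - y) := tsupport_mul_subset_right hz
    have h3 : tsupport (fun y => η (x - y)) ⊆ (fun y => x - y) ⁻¹' tsupport η :=
      closure_minimal (fun y hy => subset_tsupport η hy)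
        ((isClosed_tsupport η).preimage (by fun_prop))
    exact h3 h2
  have hu : LocallyIntegrable (D.indicator fun y => ζ y • v y) :=
    ((memLp_indicator_iff_restrict hD).mpr
      (memLp_smul_of_continuous hD hDb hv hζ.continuous)).locallyIntegrable (by norm_num)
  rw [planarCurl_mollify h hu, hμ.integral_eq _ htest]
  have e1 : ∫ y, inner ℝ (D.indicator (fun y => ζ y • v y) y) (gradPerp (fun y => η (x - y)) y)
      = ∫ y in D, inner ℝ (v y) (ζ y • gradPerp (fun y => η (x - y)) y) := by
    rw [← integral_indicator hD]
    congr 1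
    ext y
    by_cases hy : y ∈ D
    · simp only [indicator_of_mem hy, real_inner_smul_left, real_inner_smul_right]
    · simp only [indicator_of_notMem hy, inner_zero_left]
  have e2 : mollify η (D.indicator fun y => inner ℝ (v y) (gradPerp ζ y)) x
      = ∫ y in D, inner ℝ (v y) (η (x - y) • gradPerp ζ y) := by
    rw [← integral_indicator hD, mollify, convolution_def,
      ← integral_sub_left_eq_self _ volume x]
    congr 1
    ext y
    rw [sub_sub_cancel]
    by_cases hy : y ∈ D
    · simp [indicator_of_mem hy, real_inner_smul_right]
    · simp [indicator_of_notMem hy]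
  have i1 : Integrable (fun y => inner ℝ (v y) (ζ y • gradPerp (fun y => η (x - y)) y))
      (volume.restrict D) :=
    memLp_one_iff_integrable.mp
      (memLp_inner_of_continuous hD hDb hv1 (hζ.continuous.smul (continuous_gradPerp hφ1)))
  have i2 : Integrable (fun y => inner ℝ (v y) (η (x - y) • gradPerp ζ y))
      (volume.restrict D) :=
    memLp_one_iff_integrable.mp
      (memLp_inner_of_continuous hD hDb hv1 (hφ1.continuous.smul (continuous_gradPerp hζ1)))
  -- The product rule: one term is the mollified curl, the other is the commutator with ζ.
  have e3 : ∫ y in D, inner ℝ (v y) (gradPerp (fun y => ζ y * η (x - y)) y)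
      = (∫ y in D, inner ℝ (v y) (ζ y • gradPerp (fun y => η (x - y)) y))
        + ∫ y in D, inner ℝ (v y) (η (x - y) • gradPerp ζ y) := by
    rw [← integral_add i1 i2]
    congr 1
    ext y
    rw [gradPerp_mul (hζ1.differentiable one_ne_zero y) (hφ1.differentiable one_ne_zero y),
      inner_add_right]
  rw [e1, e2, e3]
  ring

theorem measurable_lintegral_mul_mollifier {ρ : Measure Space} [SFinite ρ] {η ζ : Space → ℝ}
    (hη : Continuous η) (hζ : Continuous ζ) :
    Measurable fun x => ∫⁻ y, ‖ζ y * η (x - y)‖ₑ ∂ρ := by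
  refine Measurable.lintegral_prod_right (f := fun x y => ‖ζ y * η (x - y)‖ₑ) ?_
  have : Continuous fun z : Space × Space => ζ z.2 * η (z.1 - z.2) := by fun_prop
  exact this.measurable.enorm

/-- Tonelli: mollifying a measure with a probability density preserves mass. This gives the sharp
constant 1 in front of |curl v|(D). -/
theorem IsMollifier.lintegral_lintegral_mul {ρ : Measure Space} [SFinite ρ] {η ζ : Space → ℝ}
    {c : Space} {r : ℝ} (h : IsMollifier η c r) (hζ : Continuous ζ) :
    ∫⁻ x, ∫⁻ y, ‖ζ y * η (x - y)‖ₑ ∂ρ = ∫⁻ y, ‖ζ y‖ₑ ∂ρ := by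
  have hη := h.contDiff.continuous
  have hc : Continuous fun z : Space × Space => ζ z.2 * η (z.1 - z.2) := by fun_prop
  rw [lintegral_lintegral_swap (f := fun x y => ‖ζ y * η (x - y)‖ₑ)
    hc.measurable.enorm.aemeasurable]
  congr 1
  ext y
  simp only [enorm_mul]
  have h1 : ∫⁻ x, ‖η x‖ₑ = 1 := by
    rw [← h.lintegral_eq_one]
    congr 1
    ext x
    exact Real.enorm_of_nonneg (h.nonneg x)
  rw [lintegral_const_mul' _ _ enorm_ne_top, lintegral_sub_right_eq_self (fun x => ‖η x‖ₑ) y, h1,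
    mul_one]

/-- A mollifier that shifts along the interior cone, so that mollified truncations near `p` only
see `D` from inside. -/
theorem HasInteriorConeAt.exists_isMollifier {D : Set Space} {p : Space}
    (h : HasInteriorConeAt D p) : ∃ δ > 0, ∀ ε > 0, ∃ (η : Space → ℝ) (c : Space) (r : ℝ),
      IsMollifier η c r ∧ Metric.ball c r ⊆ Metric.ball 0 ε ∧
      ∀ x ∈ D, ∀ z ∈ Metric.ball p δ, x - z ∈ tsupport η → z ∈ D := by
  obtain ⟨y, δ, hδ, h⟩ := h
  refine ⟨δ / 2, half_pos hδ, fun ε hε => ?_⟩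
  -- The kernel moves points by less than t(‖y‖ + δ): at most ε puts it in the required ball, at
  -- most δ/2 keeps x within δ of p when z is within δ/2.
  set t : ℝ := min (δ / 2) (min ε (δ / 2) / (‖y‖ + δ)) with ht
  have hy : 0 < ‖y‖ + δ := by positivity
  have ht0 : 0 < t := by positivity
  have htδ : t < δ := (min_le_left _ _).trans_lt (half_lt_self hδ)
  have htm : t * (‖y‖ + δ) ≤ min ε (δ / 2) := by
    rw [← le_div_iff₀ hy]; exact min_le_right _ _
  have htε : t * (‖y‖ + δ) ≤ ε := htm.trans (min_le_left _ _)
  have htδ2 : t * (‖y‖ + δ) ≤ δ / 2 := htm.trans (min_le_right _ _)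
  have hty : ‖t • y‖ = t * ‖y‖ := by rw [norm_smul, Real.norm_of_nonneg ht0.le]
  -- Convolution at x samples x - s with s in the support of η, so centring at -ty samples around x
  -- + ty. Half the cone radius makes the closed support fit in the open ball.
  obtain ⟨η, hη⟩ := _root_.exists_isMollifier (-(t • y)) (r := δ * t / 2) (by positivity)
  have hδt : 0 < δ * t := by positivity
  refine ⟨η, _, _, hη, fun z hz => ?_, fun x hx z hz hxz => ?_⟩
  · rw [Metric.mem_ball, dist_eq_norm] at hz ⊢
    rw [sub_neg_eq_add] at hz
    rw [sub_zero]
    calc ‖z‖ = ‖(z + t • y) - t • y‖ := by rw [add_sub_cancel_right]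
      _ ≤ ‖z + t • y‖ + ‖t • y‖ := norm_sub_le _ _
      _ < ε := by rw [hty]; linarith
  · have hts : x - z ∈ Metric.closedBall (-(t • y)) (δ * t / 2) :=
      closure_minimal (hη.support_subset.trans Metric.ball_subset_closedBall)
        Metric.isClosed_closedBall hxz
    rw [Metric.mem_closedBall, dist_eq_norm, sub_neg_eq_add] at hts
    refine h x hx ?_ t ⟨ht0, htδ⟩ ?_
    · rw [Metric.mem_ball] at hz
      have : dist x z < δ / 2 := by
        rw [dist_eq_norm]
        calc ‖x - z‖ = ‖(x - z + t • y) - t • y‖ := by rw [add_sub_cancel_right]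
          _ ≤ ‖x - z + t • y‖ + ‖t • y‖ := norm_sub_le _ _
          _ < δ / 2 := by rw [hty]; linarith
      linarith [dist_triangle x z p]
    · rw [Metric.mem_ball, dist_comm, dist_eq_norm]
      have : x + t • y - z = x - z + t • y := by abel
      rw [this]
      linarith

/-! ### Gluing the local approximations -/

/-- Approximation in `L²` by smooth fields whose curl is almost not larger. -/
theorem IsCurl.exists_contDiff_approx {D : Set Space} (hD : IsOpen D)
    (hDb : Bornology.IsBounded D) (hcone : ∀ p ∈ closure D, HasInteriorConeAt D p)
    {v : Space → Plane} {μ : SignedMeasure Space} (hμ : IsCurl D v μ)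
    (hv : MemLp v 2 (volume.restrict D)) {ε : ℝ≥0∞} (hε : ε ≠ 0) :
    ∃ w : Space → Plane, ContDiff ℝ ∞ w ∧ eLpNorm (w - v) 2 (volume.restrict D) ≤ ε ∧
      ∫⁻ x in D, ‖planarCurl w x‖ₑ ≤ μ.totalVariation D + ε := by
  have hDm := hD.measurableSet
  choose! δ hδ hmoll using fun p hp => (hcone p hp).exists_isMollifier
  obtain ⟨s, hsD, hs⟩ := hDb.isCompact_closure.elim_nhds_subcover
    (fun p => Metric.ball p (δ p)) fun p hp => Metric.ball_mem_nhds p (hδ p hp)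
  obtain ⟨ζ, hζ⟩ := SmoothPartitionOfUnity.exists_isSubordinate
    (modelWithCornersSelf ℝ Space) (s := closure D) isClosed_closure
    (fun i : s => Metric.ball (i : Space) (δ i)) (fun i => Metric.isOpen_ball)
    (by rwa [← Finset.set_biUnion_coe, biUnion_eq_iUnion] at hs)
  have hζc : ∀ i, ContDiff ℝ ∞ (ζ i) := fun i => (ζ i).contMDiff.contDiff
  have hζ1 : ∀ i, ContDiff ℝ 1 (ζ i) := fun i => (hζc i).of_le (by norm_num)
  have hsum : ∀ x ∈ closure D, ∑ i, ζ i x = 1 := fun x hx => by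
    rw [← finsum_eq_sum_of_fintype]; exact ζ.sum_eq_one hx
  let u : s → Space → Plane := fun i => D.indicator fun y => ζ i y • v y
  let g : s → Space → ℝ := fun i => D.indicator fun y => inner ℝ (v y) (gradPerp (ζ i) y)
  have hu : ∀ i, MemLp (u i) 2 := fun i => (memLp_indicator_iff_restrict hDm).mpr
    (memLp_smul_of_continuous hDm hDb hv (hζc i).continuous)
  have hg : ∀ i, MemLp (g i) 2 := fun i => (memLp_indicator_iff_restrict hDm).mpr
    (memLp_inner_of_continuous hDm hDb hv (continuous_gradPerp (hζ1 i)))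
  have hgsum : ∀ x ∈ D, ∑ i, g i x = 0 := fun x hx => by
    have h0 : fderiv ℝ (fun y => ∑ i, ζ i y) x = 0 := by
      have : (fun y => ∑ i, ζ i y) =ᶠ[𝓝 x] fun _ => (1 : ℝ) := by
        filter_upwards [hD.mem_nhds hx] with y hy using hsum y (subset_closure hy)
      rw [this.fderiv_eq, fderiv_fun_const, Pi.zero_apply]
    rw [fderiv_fun_sum fun i _ => (hζ1 i).differentiable one_ne_zero x] at h0
    have h1 : ∀ e : Space, ∑ i, fderiv ℝ (ζ i) x e = 0 := fun e => by
      rw [← _root_.sum_apply, h0, _root_.zero_apply]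
    simp only [g, indicator_of_mem hx, inner_gradPerp, Finset.sum_sub_distrib, ← Finset.sum_mul,
      h1, zero_mul, sub_zero]
  have husum : ∀ x ∈ D, ∑ i, u i x = v x := fun x hx => by
    simp only [u, indicator_of_mem hx, ← Finset.sum_smul, hsum x (subset_closure hx), one_smul]
  -- The Cauchy–Schwarz constant from L² to L¹ on D. The factor 1 + M lets one ε' serve both the L²
  -- error of the field and the L¹ error of the commutators.
  set M : ℝ≥0∞ := volume D ^ (1 / 2 : ℝ) with hM
  have hMt : M ≠ ⊤ := ENNReal.rpow_ne_top_of_nonneg (by positivity) hDb.measure_lt_top.ne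
  obtain ⟨ε', hε', hε'ε⟩ := ENNReal.exists_nnreal_pos_mul_lt
    (a := (s.card : ℝ≥0∞) * (1 + M)) (b := ε)
    (ENNReal.mul_ne_top (by simp) (by simp [hMt])) hε
  have hε'0 : (ε' : ℝ≥0∞) ≠ 0 := by simpa using hε'.ne'
  have hker : ∀ i : s, ∃ (η : Space → ℝ) (c : Space) (r : ℝ), IsMollifier η c r ∧
      eLpNorm (mollify η (u i) - u i) 2 ≤ ε' ∧ eLpNorm (mollify η (g i) - g i) 2 ≤ ε' ∧
      ∀ x ∈ D, ∀ z ∈ Metric.ball (i : Space) (δ i), x - z ∈ tsupport η → z ∈ D := fun i => by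
    obtain ⟨a, ha, h1⟩ := exists_eLpNorm_mollify_sub_le (by norm_num) (by simp) (hu i) hε'0
    obtain ⟨b, hb, h2⟩ := exists_eLpNorm_mollify_sub_le (by norm_num) (by simp) (hg i) hε'0
    obtain ⟨η, c, r, hη, hsub, h3⟩ := hmoll i (hsD i i.2) (min a b) (lt_min ha hb)
    exact ⟨η, c, r, hη,
      h1 η (hη.mono (hsub.trans (Metric.ball_subset_ball (min_le_left _ _)))),
      h2 η (hη.mono (hsub.trans (Metric.ball_subset_ball (min_le_right _ _)))), h3⟩
  choose η c r hη hηu hηg hηD using hker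
  have hsm : ∀ i, ContDiff ℝ ∞ (mollify (η i) (u i)) := fun i =>
    (hη i).contDiff_mollify ((hu i).locallyIntegrable (by norm_num))
  have hgm : ∀ i, ContDiff ℝ ∞ (mollify (η i) (g i)) := fun i =>
    (hη i).contDiff_mollify ((hg i).locallyIntegrable (by norm_num))
  have hcard : ∀ C : ℝ≥0∞, C ≤ 1 + M → ∑ _i : s, ε' * C ≤ ε := fun C hC => by
    rw [Finset.sum_const, Finset.card_univ, Fintype.card_coe, nsmul_eq_mul]
    refine le_trans ?_ hε'ε.le
    rw [← mul_assoc, mul_comm (ε' : ℝ≥0∞) (s.card * _), mul_assoc, mul_assoc,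
      mul_comm (ε' : ℝ≥0∞)]
    gcongr
  refine ⟨∑ i, mollify (η i) (u i), ?_, ?_, ?_⟩
  · have := ContDiff.sum (s := Finset.univ) fun i _ => hsm i
    convert this using 1
    ext1 x
    rw [Finset.sum_apply]
  · have e : ∑ i, mollify (η i) (u i) - v
        =ᵐ[volume.restrict D] ∑ i, (mollify (η i) (u i) - u i) := by
      filter_upwards [ae_restrict_mem hDm] with x hx
      rw [Pi.sub_apply, Finset.sum_apply, Finset.sum_apply, ← husum x hx,
        ← Finset.sum_sub_distrib]
      rfl
    rw [eLpNorm_congr_ae e]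
    refine (eLpNorm_sum_le (fun i _ => ((hsm i).continuous.aestronglyMeasurable.sub
      (hu i).1.restrict)) (by norm_num)).trans ?_
    calc _ ≤ ∑ _i : s, (ε' : ℝ≥0∞) * 1 := Finset.sum_le_sum fun i _ => by
          rw [mul_one]
          exact (eLpNorm_mono_measure _ Measure.restrict_le_self).trans (hηu i)
      _ ≤ ε := hcard 1 le_self_add
  · set T : s → Space → ℝ≥0∞ := fun i x =>
      ∫⁻ y, ‖ζ i y * η i (x - y)‖ₑ ∂μ.totalVariation with hT
    have hTm : ∀ i, Measurable (T i) := fun i =>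
      measurable_lintegral_mul_mollifier (hη i).contDiff.continuous (hζc i).continuous
    have hpt : ∀ x ∈ D, ‖planarCurl (∑ i, mollify (η i) (u i)) x‖ₑ
        ≤ (∑ i, T i x) + ∑ i, ‖(mollify (η i) (g i) - g i) x‖ₑ := fun x hx => by
      rw [planarCurl_sum _ fun i _ => (hsm i).differentiable (by simp) x]
      have h1 : ∀ i, planarCurl (mollify (η i) (u i)) x
          = signedIntegral μ (fun y => ζ i y * η i (x - y)) + mollify (η i) (g i) x := fun i =>
        hμ.planarCurl_mollify_smul hDm hDb hv (hη i) (hζc i) fun z hz hxz =>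
          hηD i x hx z (hζ i hz) hxz
      -- Subtracting ∑ g_i = 0 turns the commutators, which are not small individually, into
      -- mollification errors.
      have h2 : ∑ i, planarCurl (mollify (η i) (u i)) x
          = (∑ i, signedIntegral μ (fun y => ζ i y * η i (x - y)))
            + ∑ i, (mollify (η i) (g i) - g i) x := by
        simp only [h1, Finset.sum_add_distrib, Pi.sub_apply, Finset.sum_sub_distrib,
          hgsum x hx, sub_zero]
      rw [h2]
      refine (enorm_add_le _ _).trans (add_le_add ?_ (enorm_sum_le _ _))
      exact (enorm_sum_le _ _).trans
        (Finset.sum_le_sum fun i _ => enorm_signedIntegral_le _ _)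
    have hmain : ∑ i, ∫⁻ x in D, T i x ≤ μ.totalVariation D := by
      calc ∑ i, ∫⁻ x in D, T i x ≤ ∑ i, ∫⁻ y, ‖ζ i y‖ₑ ∂μ.totalVariation :=
            Finset.sum_le_sum fun i _ => (setLIntegral_le_lintegral _ _).trans
              ((hη i).lintegral_lintegral_mul (hζc i).continuous).le
        _ = ∫⁻ y, ∑ i, ‖ζ i y‖ₑ ∂μ.totalVariation :=
          (lintegral_finsetSum _ fun i _ => (hζc i).continuous.measurable.enorm).symm
        _ = ∫⁻ _, 1 ∂μ.totalVariation := by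
          refine lintegral_congr_ae ?_
          -- The ζ_i sum to 1 only on the closure of D, which carries all of |μ|.
          have : ∀ᵐ x ∂μ.totalVariation, x ∈ D := hμ.concentrated
          filter_upwards [this] with x hx
          have hn : ∀ i, ‖ζ i x‖ₑ = ENNReal.ofReal (ζ i x) := fun i =>
            Real.enorm_of_nonneg (ζ.nonneg i x)
          simp only [hn]
          rw [← ENNReal.ofReal_sum_of_nonneg fun i _ => ζ.nonneg i x,
            hsum x (subset_closure hx), ENNReal.ofReal_one]
        _ = μ.totalVariation D := by
          rw [lintegral_one, ← measure_add_measure_compl hDm, hμ.concentrated, add_zero]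
    have hrest : ∑ i, ∫⁻ x in D, ‖(mollify (η i) (g i) - g i) x‖ₑ ≤ ε := by
      refine le_trans (Finset.sum_le_sum fun i _ => ?_) (hcard M le_add_self)
      rw [← eLpNorm_one_eq_lintegral_enorm]
      refine (eLpNorm_le_eLpNorm_mul_rpow_measure_univ (p := 1) (q := 2) (by norm_num)
        ((hgm i).continuous.aestronglyMeasurable.sub (hg i).1.restrict)).trans ?_
      rw [Measure.restrict_apply_univ]
      have he : (1 / (1 : ℝ≥0∞).toReal - 1 / (2 : ℝ≥0∞).toReal) = (1 / 2 : ℝ) := by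
        norm_num
      rw [he]
      gcongr
      exact (eLpNorm_mono_measure _ Measure.restrict_le_self).trans (hηg i)
    calc _ ≤ ∫⁻ x in D, ((∑ i, T i x) + ∑ i, ‖(mollify (η i) (g i) - g i) x‖ₑ) :=
          setLIntegral_mono' hDm hpt
      _ = (∑ i, ∫⁻ x in D, T i x) + ∑ i, ∫⁻ x in D, ‖(mollify (η i) (g i) - g i) x‖ₑ := by
        rw [lintegral_add_left (Finset.measurable_fun_sum _ fun i _ => hTm i),
          lintegral_finsetSum _ fun i _ => hTm i, lintegral_finsetSum' _ fun i _ =>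
            ((hgm i).continuous.aestronglyMeasurable.sub (hg i).1.restrict).enorm]
      _ ≤ _ := add_le_add hmain hrest

/-! ### Lower semicontinuity and conclusion -/

/-- Lower semicontinuity of the total variation of the curl under `L²` convergence. -/
theorem eventually_lt_curlVariation {D : Set Space} (hD : IsOpen D) (hDb : Bornology.IsBounded D)
    {v : Space → Plane} (hv : v ∈ curlSpace D) {w : ℕ → Space → Plane}
    (hw : ∀ k, w k ∈ curlSpace D)
    (hlim : Tendsto (fun k => eLpNorm (w k - v) 2 (volume.restrict D)) atTop (𝓝 0))
    {c : ℝ≥0∞} (hc : c < curlVariation D v) : ∀ᶠ k in atTop, c < curlVariation D (w k) := by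
  obtain ⟨hv2, μ, hμ⟩ := hv
  have hDm := hD.measurableSet
  have hfin : IsFiniteMeasure (volume.restrict D) := ⟨by simpa using hDb.measure_lt_top⟩
  rw [curlVariation, hμ.curlMeasure_eq hD] at hc
  -- This φ depends only on v and c, and it is a competitor for the variation of every `w k`.
  obtain ⟨φ, hφ, hφ1, hcφ⟩ := exists_testFunction_lt_signedIntegral hD hμ.concentrated hc
  choose hw2 ν hν using hw
  have hg := continuous_gradPerp hφ.contDiff
  have hint : ∀ {z : Space → Plane}, MemLp z 2 (volume.restrict D) →
      Integrable (fun x => inner ℝ (z x) (gradPerp φ x)) (volume.restrict D) := fun hz =>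
    memLp_one_iff_integrable.mp
      (memLp_inner_of_continuous hDm hDb (hz.mono_exponent (by norm_num)) hg)
  obtain ⟨C, hC⟩ := hDb.isCompact_closure.exists_bound_of_continuousOn hg.continuousOn
  have hC0 : 0 ≤ max C 0 := le_max_right _ _
  have hlim1 : Tendsto (fun k => eLpNorm (fun x => inner ℝ (w k x) (gradPerp φ x)
      - inner ℝ (v x) (gradPerp φ x)) 1 (volume.restrict D)) atTop (𝓝 0) := by
    have hb : Tendsto (fun k => ENNReal.ofReal C * (eLpNorm (w k - v) 2 (volume.restrict D)
        * volume.restrict D univ ^ (1 / (1 : ℝ≥0∞).toReal - 1 / (2 : ℝ≥0∞).toReal))) atTop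
        (𝓝 0) := by
      have h1 := ENNReal.Tendsto.mul_const hlim
        (b := volume.restrict D univ ^ (1 / (1 : ℝ≥0∞).toReal - 1 / (2 : ℝ≥0∞).toReal))
        (Or.inr (ENNReal.rpow_ne_top_of_nonneg (by norm_num) (measure_ne_top _ _)))
      have h2 := ENNReal.Tendsto.const_mul (a := ENNReal.ofReal C) h1
        (Or.inr ENNReal.ofReal_ne_top)
      simpa using h2
    refine tendsto_of_tendsto_of_tendsto_of_le_of_le tendsto_const_nhds hb
      (fun _ => zero_le) fun k => ?_
    have h1 : eLpNorm (fun x => inner ℝ (w k x) (gradPerp φ x)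
        - inner ℝ (v x) (gradPerp φ x)) 1 (volume.restrict D)
        ≤ ENNReal.ofReal C * eLpNorm (w k - v) 1 (volume.restrict D) := by
      refine eLpNorm_le_mul_eLpNorm_of_ae_le_mul ?_ 1
      filter_upwards [ae_restrict_mem hDm] with x hx
      rw [← inner_sub_left, mul_comm]
      refine (norm_inner_le_norm _ _).trans ?_
      rw [Pi.sub_apply]
      gcongr
      exact hC x (subset_closure hx)
    refine h1.trans ?_
    gcongr
    exact eLpNorm_le_eLpNorm_mul_rpow_measure_univ (by norm_num) ((hw2 k).1.sub hv2.1)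
  have hI : Tendsto (fun k => ∫ x in D, inner ℝ (w k x) (gradPerp φ x)) atTop
      (𝓝 (∫ x in D, inner ℝ (v x) (gradPerp φ x))) :=
    tendsto_integral_of_L1' _ (hint hv2).1 (Eventually.of_forall fun k => hint (hw2 k)) hlim1
  have hS : Tendsto (fun k => ENNReal.ofReal (signedIntegral (ν k) φ)) atTop
      (𝓝 (ENNReal.ofReal (signedIntegral μ φ))) := by
    simp only [(hν _).integral_eq φ hφ, hμ.integral_eq φ hφ]
    exact ENNReal.tendsto_ofReal hI.neg
  filter_upwards [hS.eventually_const_lt hcφ] with k hk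
  refine hk.trans_le ?_
  rw [curlVariation, (hν k).curlMeasure_eq hD]
  calc ENNReal.ofReal (signedIntegral (ν k) φ) ≤ ‖signedIntegral (ν k) φ‖ₑ :=
        Real.ofReal_le_enorm _
    _ ≤ ∫⁻ x, ‖φ x‖ₑ ∂(ν k).totalVariation := enorm_signedIntegral_le _ _
    _ ≤ ∫⁻ _, 1 ∂(ν k).totalVariation := lintegral_mono fun x => by
      rw [← ofReal_norm, Real.norm_eq_abs]
      exact ENNReal.ofReal_le_one.mpr (hφ1 x)
    _ = (ν k).totalVariation D := by
      rw [lintegral_one, ← measure_add_measure_compl hDm, (hν k).concentrated, add_zero]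

theorem mem_curlSpace_of_contDiff {D : Set Space} (hD : MeasurableSet D)
    (hDb : Bornology.IsBounded D) {w : Space → Plane} (hw : ContDiff ℝ 1 w) : w ∈ curlSpace D := by
  have hfin : IsFiniteMeasure (volume.restrict D) := ⟨by simpa using hDb.measure_lt_top⟩
  obtain ⟨C, hC⟩ := hDb.isCompact_closure.exists_bound_of_continuousOn hw.continuous.continuousOn
  refine ⟨MemLp.of_bound hw.continuous.aestronglyMeasurable C ?_, _,
    isCurl_withDensityᵥ hD hDb hw⟩
  filter_upwards [ae_restrict_mem hD] with x hx using hC x (subset_closure hx)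

theorem proposition2p2 (Ω : Set Plane) (hΩ : IsBoundedSmoothDomain Ω) (hsc : IsSimplyConnected Ω)
    (L : ℝ) (hL : 0 < L) (v : Space → Plane) (hv : v ∈ curlSpace (openCylinder Ω L)) :
    ∃ w : ℕ → Space → Plane,
      (∀ k, w k ∈ curlSpace (openCylinder Ω L) ∧ IsSmoothUpToBoundary (openCylinder Ω L) (w k)) ∧
      Tendsto (fun k => eLpNorm (w k - v) 2 (volume.restrict (openCylinder Ω L))) atTop (𝓝 0) ∧
      Tendsto (fun k => curlVariation (openCylinder Ω L) (w k)) atTop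
        (𝓝 (curlVariation (openCylinder Ω L) v)) := by
  have hD := isOpen_openCylinder hΩ.isOpen L
  have hDb := isBounded_openCylinder hΩ.isBounded L
  obtain ⟨hv2, μ, hμ⟩ := id hv
  -- The tolerance at k = 0 is ⊤, which is nonzero and does not affect the limit.
  have hε0 : ∀ k : ℕ, ((k : ℝ≥0∞))⁻¹ ≠ 0 := fun k => by simp
  choose w hw hwv hwc using fun k : ℕ => hμ.exists_contDiff_approx hD hDb
    (fun p hp => hasInteriorConeAt_openCylinder hΩ hL hp) hv2 (hε0 k)
  have hw1 : ∀ k, ContDiff ℝ 1 (w k) := fun k => (hw k).of_le (by norm_num)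
  have hmem : ∀ k, w k ∈ curlSpace (openCylinder Ω L) := fun k =>
    mem_curlSpace_of_contDiff hD.measurableSet hDb (hw1 k)
  have hinv : Tendsto (fun k : ℕ => ((k : ℝ≥0∞))⁻¹) atTop (𝓝 0) :=
    ENNReal.tendsto_inv_nat_nhds_zero
  have hlim : Tendsto (fun k => eLpNorm (w k - v) 2 (volume.restrict (openCylinder Ω L)))
      atTop (𝓝 0) :=
    tendsto_of_tendsto_of_tendsto_of_le_of_le tendsto_const_nhds hinv (fun _ => zero_le) hwv
  refine ⟨w, fun k => ⟨hmem k, w k, hw k, fun _ _ => rfl⟩, hlim, tendsto_order.mpr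
    ⟨fun c hc => eventually_lt_curlVariation hD hDb hv hmem hlim hc, fun c hc => ?_⟩⟩
  have hup : Tendsto (fun k : ℕ => μ.totalVariation (openCylinder Ω L) + ((k : ℝ≥0∞))⁻¹) atTop
      (𝓝 (μ.totalVariation (openCylinder Ω L))) := by
    simpa using hinv.const_add (μ.totalVariation (openCylinder Ω L))
  rw [curlVariation, hμ.curlMeasure_eq hD] at hc
  filter_upwards [hup.eventually_lt_const hc] with k hk
  rw [curlVariation_eq_lintegral hD hDb (hw1 k)]
  exact (hwc k).trans_lt hk
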